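/- For $x\in\mathbb R^d$ let $\|x\|_p=(\sum_i|x_i|^p)^{1/p}$ and $\|x\|_\infty=\max_i|x_i|$; let $\mathrm{Ham}$ be the Hamming distance on $\{0,1\}^{m}$. A distribution over maps $\mathbb R^d\to\{0,1\}^{m}$ is a probability measure on the set of all such maps with the product $\sigma$-algebra. For $D,s>0$, a map $\varphi:\mathbb R^d\to\{0,1\}^{m}$ embeds a finite set $X\subset\mathbb R^d$ from $\ell_p$ into the Hamming cube with distortion $D$ and scaling $s$ if $s\|x-y\|_p\le \mathrm{Ham}(\varphi(x),\varphi(y))\le D\,s\,\|x-y\|_p$ for all $x,y\in X$. (1) There is a universal constant $D$ and, for every $p\in(1,2]$, a constant $C_p$ depending only on $p$, such that for all $n,d\in\mathbb N$ and $\Phi\ge 0$ there is $d'\in\mathbb N$ with $d'\le C_p\,\Phi\log n$ for which the following holds. For every scale $R>0$ there are $s>0$ and a distribution $\mathcal E_p$ over maps $\varphi:\mathbb R^d\to\{0,1\}^{d'}$ such that, for every fixed set $X\subset\mathbb R^d$ of at most $n$ points with $$\max_{x,y\in X}\|x-y\|_p\le R\qquad\text{and}\qquad \frac{R}{\min_{x\ne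 y\in X}\|x-y\|_p}\le\Phi$$ (in particular, for every $X$ of at most $n$ points with $\ell_p$-diameter $R$ and $\ell_p$ aspect ratio $\max_{x,y\in X}\|x-y\|_p/\min_{x\neq y\in X}\|x-y\|_p\le\Phi$), a draw $\varphi\sim\mathcal E_p$ embeds $X$ from $\ell_p$ into the Hamming cube with distortion $D$ and scaling $s$ with probability at least $1-1/n^{10}$. (2) There are universal constants $C,D$ such that for all $n,d\in\mathbb N$, $r>0$ and $R\ge 0$ there are $d'\in\mathbb N$ with $d'\le C\,dR\log n/r$, $s>0$, and a distribution $\mathcal E_1$ over maps $\varphi:\mathbb R^d\to\{0,1\}^{d'}$ such that, for every fixed set $X\subset\mathbb R^d$ of at most $n$ points with $\|x-y\|_\infty\le R$ and $\|x-y\|_1\ge r$ for all distinct $x,y\in X$, a draw $\varphi\sim\mathcal E_1$ embeds $X$ from $\ell_1$ into the Hamming cube with distortion $D$ and scaling $s$ with probability at least $1-1/n^{10}$. (For sets $X$ with at most one point the condition on the minimum distance is void. For $n=0$ the set $X$ is empty, $\log n$ is read as $0$, and the probability is $1$.) -/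

import Mathlib

open MeasureTheory

noncomputable section

/-- The `ℓ_p` distance `‖x - y‖_p` on `ℝ^d`, through Mathlib's `ℓ_p` norm on `PiLp`. -/
def lpDist {d : ℕ} (p : ℝ) (x y : Fin d → ℝ) : ℝ :=
  ‖WithLp.toLp (ENNReal.ofReal p) (x - y)‖

/-- Explicit form of the `ℓ_p` distance. -/
theorem lpDist_eq {d : ℕ} {p : ℝ} (hp : 0 < p) (x y : Fin d → ℝ) :
    lpDist p x y = (∑ i, |x i - y i| ^ p) ^ (1 / p) := by
  have h : 0 < (ENNReal.ofReal p).toReal := by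
    rwa [ENNReal.toReal_ofReal hp.le]
  rw [lpDist, PiLp.norm_eq_sum h, ENNReal.toReal_ofReal hp.le]
  simp [Real.norm_eq_abs]

/-- The largest `ℓ_p` distance `max_{x, y ∈ X} ‖x - y‖_p` in a finite set
(`0` for the empty set). -/
def lpMaxDist {d : ℕ} (p : ℝ) (X : Finset (Fin d → ℝ)) : ℝ :=
  sSup {t : ℝ | ∃ x ∈ X, ∃ y ∈ X, t = lpDist p x y}

/-- The smallest `ℓ_p` distance `min_{x ≠ y ∈ X} ‖x - y‖_p` between distinct points of a finite
set (`0` if the set has at most one point). The aspect ratio of `X` in `ℓ_p` is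
`lpMaxDist p X / lpMinDist p X`. -/
def lpMinDist {d : ℕ} (p : ℝ) (X : Finset (Fin d → ℝ)) : ℝ :=
  sInf {t : ℝ | ∃ x ∈ X, ∃ y ∈ X, x ≠ y ∧ t = lpDist p x y}

/-- `f`, restricted to `X`, embeds the `ℓ_p` distance into the hypercube with the Hamming distance
with distortion at most `D`, where `s` is the scaling factor. -/
def EmbedsWithDistortion {d m : ℕ} (p D s : ℝ) (X : Finset (Fin d → ℝ))
    (f : (Fin d → ℝ) → (Fin m → Bool)) : Prop :=
  ∀ x ∈ X, ∀ y ∈ X,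
    s * lpDist p x y ≤ (hammingDist (f x) (f y) : ℝ) ∧
      (hammingDist (f x) (f y) : ℝ) ≤ D * (s * lpDist p x y)

end

/-! It suffices to find one random cut `h : ℝ^d → {0,1}` that separates each pair at distance `δ`
with probability between `Lδ` and `2Lδ`. The Hamming distance of `m` independent copies is then
binomial. If its mean is at least `39 log n`, a Chernoff bound and a union bound over pairs keep all
distances within a factor `4` of their means, so the distortion is `4 · 4 · 2 = 32`.

The cut projects `x` to a random real `g x`, adds a uniform shift and applies the periodic colouring
`halfCut`. Reals `a, b` are separated with probability exactly `2|a - b|` if `|a - b| ≤ 1/2`, and at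
most `2|a - b|` always. Hence it is enough that truncating `|g x - g y|` at `1/2` keeps at least
half of its mean.

For `p = 1`, `g` is a uniformly random coordinate divided by `2R`; the sup norm bound makes
truncation vacuous. For `1 < p ≤ 2`, `g` is a linear functional with independent `p`-stable
coefficients, so `g x - g y` is a multiple of `‖x - y‖_p` times one stable variable `s`
(`map_sum_mul_pi_stable`). As `p > 1`, `|s|` has a finite mean `M`, and some level `K` retains half
of it; dividing by `2KR` matches this level to `1/2`. Only the dimension feels `K / M`, so `D` does
not depend on `p`.

Stable laws with `p < 2` arise by Lévy's theorem as limits of sums of symmetrised Pareto variables;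
for `p = 2` the law is Gaussian. -/

/-! ### Concentration and the union bound -/

/-- The moment generating function of the number of successes in `m` independent trials. -/
theorem integral_exp_mul_card_filter_le {Ω : Type*} [MeasurableSpace Ω] (P : Measure Ω)
    [IsProbabilityMeasure P] {A : Set Ω} (hA : MeasurableSet A) [DecidablePred (· ∈ A)]
    (m : ℕ) (t : ℝ) :
    ∫ ω : Fin m → Ω, Real.exp (t * ((Finset.univ.filter fun j => ω j ∈ A).card : ℝ))
      ∂(Measure.pi fun _ => P) ≤ Real.exp (m * P.real A * (Real.exp t - 1)) := by
  have h1 : ∀ ω : Fin m → Ω,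
      Real.exp (t * ((Finset.univ.filter fun j => ω j ∈ A).card : ℝ)) =
        ∏ j, (1 + A.indicator (fun _ => Real.exp t - 1) (ω j)) := by
    intro ω
    rw [Finset.card_filter, Nat.cast_sum, Finset.mul_sum, Real.exp_sum]
    refine Finset.prod_congr rfl fun j _ => ?_
    by_cases h : ω j ∈ A <;> simp [h]
  have h2 : ∫ ω, (1 + A.indicator (fun _ => Real.exp t - 1) ω) ∂P =
      1 + P.real A * (Real.exp t - 1) := by
    rw [integral_add (integrable_const _) ((integrable_const _).indicator hA),
      integral_indicator_const _ hA]
    simp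
  simp_rw [h1]
  rw [integral_fintype_prod_eq_pow (ι := Fin m)
    (fun ω => 1 + A.indicator (fun _ => Real.exp t - 1) ω), h2, Fintype.card_fin]
  have h0 : 0 ≤ 1 + P.real A * (Real.exp t - 1) := by
    have h3 : P.real A ≤ 1 := measureReal_le_one
    have h4 : 0 ≤ P.real A := measureReal_nonneg
    nlinarith [Real.exp_pos t]
  calc (1 + P.real A * (Real.exp t - 1)) ^ m
      ≤ Real.exp (P.real A * (Real.exp t - 1)) ^ m := by
        gcongr
        linarith [Real.add_one_le_exp (P.real A * (Real.exp t - 1))]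
    _ = _ := by rw [← Real.exp_nat_mul]; ring_nf

theorem measurable_card_filter_mem {Ω : Type*} [MeasurableSpace Ω]
    {A : Set Ω} (hA : MeasurableSet A) [DecidablePred (· ∈ A)] (m : ℕ) :
    Measurable fun ω : Fin m → Ω => ((Finset.univ.filter fun j => ω j ∈ A).card : ℝ) := by
  simp_rw [Finset.card_filter, Nat.cast_sum]
  refine Finset.measurable_sum _ fun j _ => ?_
  have : Measurable fun ω : Ω => (((if ω ∈ A then 1 else 0 : ℕ)) : ℝ) :=
    measurable_from_top.comp (Measurable.ite hA measurable_const measurable_const)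
  exact this.comp (measurable_pi_apply j)

theorem integrable_exp_mul_card_filter {Ω : Type*} [MeasurableSpace Ω] (P : Measure Ω)
    [IsProbabilityMeasure P] {A : Set Ω} (hA : MeasurableSet A) [DecidablePred (· ∈ A)]
    (m : ℕ) (t : ℝ) :
    Integrable (fun ω : Fin m → Ω =>
      Real.exp (t * ((Finset.univ.filter fun j => ω j ∈ A).card : ℝ)))
      (Measure.pi fun _ => P) := by
  refine Integrable.of_bound (C := Real.exp (|t| * m))
    (Real.measurable_exp.comp
      ((measurable_card_filter_mem hA m).const_mul t)).aestronglyMeasurable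
    (Filter.Eventually.of_forall fun ω => ?_)
  rw [Real.norm_eq_abs, Real.abs_exp, Real.exp_le_exp]
  have h1 : ((Finset.univ.filter fun j => ω j ∈ A).card : ℝ) ≤ m := by
    exact_mod_cast (Finset.card_filter_le _ _).trans (by simp)
  calc t * ((Finset.univ.filter fun j => ω j ∈ A).card : ℝ)
      ≤ |t| * ((Finset.univ.filter fun j => ω j ∈ A).card : ℝ) := by
        gcongr; exact le_abs_self t
    _ ≤ |t| * m := by gcongr

/-- Chernoff bound: the number of successes is within a factor `4` of its mean. -/
theorem measureReal_card_filter_not_mem_Icc_le {Ω : Type*} [MeasurableSpace Ω] (P : Measure Ω)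
    [IsProbabilityMeasure P] {A : Set Ω} (hA : MeasurableSet A) [DecidablePred (· ∈ A)] (m : ℕ) :
    (Measure.pi fun _ : Fin m => P).real
      {ω | ¬ (m * P.real A / 4 ≤ ((Finset.univ.filter fun j => ω j ∈ A).card : ℝ) ∧
        ((Finset.univ.filter fun j => ω j ∈ A).card : ℝ) ≤ 4 * (m * P.real A))} ≤
      2 * Real.exp (-(m * P.real A / 3)) := by
  set N : (Fin m → Ω) → ℝ := fun ω => ((Finset.univ.filter fun j => ω j ∈ A).card : ℝ) with hN
  set q := m * P.real A with hq
  have hq0 : 0 ≤ q := by positivity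
  have hlow : (Measure.pi fun _ : Fin m => P).real {ω | N ω ≤ q / 4} ≤
      Real.exp (-(q / 3)) := by
    refine (ProbabilityTheory.measure_le_le_exp_mul_mgf (t := -1) (q / 4) (by norm_num)
      (integrable_exp_mul_card_filter P hA m (-1))).trans ?_
    refine (mul_le_mul_of_nonneg_left (integral_exp_mul_card_filter_le P hA m (-1))
      (Real.exp_pos _).le).trans ?_
    rw [← Real.exp_add, Real.exp_le_exp, ← hq]
    -- The exponent is `q/4 + q(e⁻¹ - 1)`, which is at most `-q/3`.
    have := Real.exp_neg_one_lt_d9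
    nlinarith
  have hup : (Measure.pi fun _ : Fin m => P).real {ω | 4 * q ≤ N ω} ≤
      Real.exp (-(q / 3)) := by
    refine (ProbabilityTheory.measure_ge_le_exp_mul_mgf (t := 1) (4 * q) (by norm_num)
      (integrable_exp_mul_card_filter P hA m 1)).trans ?_
    refine (mul_le_mul_of_nonneg_left (integral_exp_mul_card_filter_le P hA m 1)
      (Real.exp_pos _).le).trans ?_
    rw [← Real.exp_add, Real.exp_le_exp, ← hq]
    -- The exponent is `-4q + q(e - 1)`, again at most `-q/3`.
    have := Real.exp_one_lt_d9
    nlinarith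
  calc _ ≤ (Measure.pi fun _ : Fin m => P).real ({ω | N ω ≤ q / 4} ∪ {ω | 4 * q ≤ N ω}) := by
        refine measureReal_mono fun ω hω => ?_
        by_contra hc
        simp only [Set.mem_union, Set.mem_ofPred_eq, not_or, not_le] at hc
        exact hω ⟨hc.1.le, hc.2.le⟩
    _ ≤ _ := (measureReal_union_le _ _).trans (by linarith)

/-- Independent copies of a random cut whose separation probability is comparable to the
`ℓ_p` distance give, with high probability, an embedding into the Hamming cube. -/
theorem exists_measure_embedsWithDistortion {Ω : Type*} [MeasurableSpace Ω] (P : Measure Ω)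
    [IsProbabilityMeasure P] {d : ℕ} {p : ℝ} (hp : 0 < p) (h : Ω → (Fin d → ℝ) → Bool)
    (hm : ∀ x, Measurable fun ω => h ω x) {m n : ℕ} (hn : 2 ≤ n) {a L : ℝ}
    (hma : 39 * Real.log n ≤ m * a) :
    ∃ E : Measure ((Fin d → ℝ) → (Fin m → Bool)), IsProbabilityMeasure E ∧
      ∀ X : Finset (Fin d → ℝ), X.card ≤ n →
        (∀ x ∈ X, ∀ y ∈ X, x ≠ y → a ≤ L * lpDist p x y ∧
          L * lpDist p x y ≤ P.real {ω | h ω x ≠ h ω y} ∧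
          P.real {ω | h ω x ≠ h ω y} ≤ 2 * (L * lpDist p x y)) →
        1 - 1 / (n : ℝ) ^ 10 ≤
          E.real {φ | EmbedsWithDistortion p 32 (m * L / 4) X φ} := by
  classical
  set Q : Measure (Fin m → Ω) := Measure.pi fun _ => P with hQ
  set F : (Fin m → Ω) → (Fin d → ℝ) → (Fin m → Bool) := fun ω x j => h (ω j) x with hF
  have hFm : Measurable F :=
    measurable_pi_iff.2 fun x => measurable_pi_iff.2 fun j =>
      (hm x).comp (measurable_pi_apply j)
  refine ⟨Q.map F, Measure.isProbabilityMeasure_map hFm.aemeasurable, fun X hX hsep => ?_⟩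
  have hn0 : (0 : ℝ) < n := by exact_mod_cast (by omega : 0 < n)
  have hn2 : (2 : ℝ) ≤ n := by exact_mod_cast hn
  set good : Set (Fin m → Ω) := F ⁻¹' {φ | EmbedsWithDistortion p 32 (m * L / 4) X φ} with hgood
  -- This inequality for push-forwards holds for every set, so measurability of the event is not
  -- needed.
  have hle : Q.real good ≤
      (Q.map F).real {φ | EmbedsWithDistortion p 32 (m * L / 4) X φ} := by
    have := Measure.isProbabilityMeasure_map (μ := Q) hFm.aemeasurable
    exact ENNReal.toReal_mono (measure_ne_top _ _) (Measure.le_map_apply hFm.aemeasurable _)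
  refine le_trans ?_ hle
  have hAm : ∀ x y, MeasurableSet {ω | h ω x ≠ h ω y} := fun x y =>
    (measurableSet_eq_fun (hm x) (hm y)).compl
  set bad : (Fin d → ℝ) × (Fin d → ℝ) → Set (Fin m → Ω) := fun z =>
    {ω | ¬ (m * P.real {ω | h ω z.1 ≠ h ω z.2} / 4 ≤
        ((Finset.univ.filter fun j => ω j ∈ {ω | h ω z.1 ≠ h ω z.2}).card : ℝ) ∧
      ((Finset.univ.filter fun j => ω j ∈ {ω | h ω z.1 ≠ h ω z.2}).card : ℝ) ≤
        4 * (m * P.real {ω | h ω z.1 ≠ h ω z.2}))} with hbad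
  have hbadle : ∀ z ∈ X.offDiag, Q.real (bad z) ≤ 2 * ((n : ℝ) ^ 13)⁻¹ := by
    rintro ⟨x, y⟩ hz
    obtain ⟨hx, hy, hxy⟩ := Finset.mem_offDiag.1 hz
    obtain ⟨h1, h2, -⟩ := hsep x hx y hy hxy
    refine (measureReal_card_filter_not_mem_Icc_le P (hAm x y) m).trans ?_
    -- Here `39 = 3 · 13`: each pair fails with probability at most `2 n⁻¹³`.
    have h3 : 13 * Real.log n ≤ m * P.real {ω | h ω x ≠ h ω y} / 3 := by
      have : (m : ℝ) * a ≤ m * P.real {ω | h ω x ≠ h ω y} := by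
        gcongr; exact h1.trans h2
      linarith
    have h4 : Real.exp (-(13 * Real.log n)) = ((n : ℝ) ^ 13)⁻¹ := by
      rw [Real.exp_neg, show (13 : ℝ) * Real.log n = (13 : ℕ) * Real.log n by norm_num,
        Real.exp_nat_mul, Real.exp_log hn0]
    rw [← h4]
    gcongr
  have hcover : goodᶜ ⊆ ⋃ z ∈ X.offDiag, bad z := by
    intro ω hω
    by_contra hc
    simp only [Set.mem_iUnion, not_exists] at hc
    refine hω fun x hx y hy => ?_
    by_cases hxy : x = y
    · subst hxy
      have : lpDist p x x = 0 := by rw [lpDist_eq hp]; simp [hp.ne']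
      simp [this]
    · have hz : (x, y) ∈ X.offDiag := Finset.mem_offDiag.2 ⟨hx, hy, hxy⟩
      have h1 := hc (x, y) hz
      simp only [hbad, Set.mem_ofPred_eq, not_not] at h1
      obtain ⟨-, h2, h3⟩ := hsep x hx y hy hxy
      have hm0 : (0 : ℝ) ≤ m := Nat.cast_nonneg m
      have h4 := mul_le_mul_of_nonneg_left h2 hm0
      have h5 := mul_le_mul_of_nonneg_left h3 hm0
      have h6 : (hammingDist (F ω x) (F ω y) : ℝ) =
          ((Finset.univ.filter fun j => h (ω j) x ≠ h (ω j) y).card : ℝ) := rfl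
      rw [h6]
      -- With `s = mL/4`, the count is at least `mLδ/4 = sδ` and at most `4 · 2mLδ = 32 sδ`.
      constructor
      · linarith [h1.1]
      · linarith [h1.2]
  have hcard : (X.offDiag.card : ℝ) ≤ (n : ℝ) ^ 2 := by
    have : X.offDiag.card ≤ n ^ 2 := by
      rw [Finset.offDiag_card, sq]
      exact (Nat.sub_le _ _).trans (Nat.mul_le_mul hX hX)
    exact_mod_cast this
  have hbound : Q.real goodᶜ ≤ 1 / (n : ℝ) ^ 10 := by
    calc Q.real goodᶜ ≤ Q.real (⋃ z ∈ X.offDiag, bad z) := 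
          measureReal_mono hcover (measure_ne_top _ _)
      _ ≤ ∑ z ∈ X.offDiag, Q.real (bad z) := 
          measureReal_biUnion_finset_le _ _
      _ ≤ ∑ z ∈ X.offDiag, 2 * ((n : ℝ) ^ 13)⁻¹ := Finset.sum_le_sum hbadle
      _ = X.offDiag.card * (2 * ((n : ℝ) ^ 13)⁻¹) := by simp
      -- The factor `2` is absorbed by `2 ≤ n`.
      _ ≤ (n : ℝ) ^ 2 * (n * ((n : ℝ) ^ 13)⁻¹) := by gcongr
      _ = 1 / (n : ℝ) ^ 10 := by field_simp
  have h1 : (1 : ℝ) ≤ Q.real good + Q.real goodᶜ := by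
    have : Q.real (good ∪ goodᶜ) ≤ Q.real good + Q.real goodᶜ := measureReal_union_le _ _
    rwa [Set.union_compl_self, probReal_univ] at this
  linarith

/-! ### Randomly shifted periodic cuts of the line -/

/-- The `1`-periodic cut of the real line into half-open intervals of length `1 / 2`. -/
noncomputable def halfCut (v : ℝ) : Bool := decide (Int.fract v < 1 / 2)

theorem measurable_halfCut : Measurable halfCut := by
  refine measurable_to_bool ?_
  have : halfCut ⁻¹' {true} = Int.fract ⁻¹' Set.Iio (1 / 2 : ℝ) := by
    ext v; simp [halfCut]
  rw [this]
  exact measurable_fract measurableSet_Iio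

theorem halfCut_add_one (v : ℝ) : halfCut (v + 1) = halfCut v := by
  simp [halfCut]

theorem measurableSet_halfCut_ne (a b : ℝ) :
    MeasurableSet {u | halfCut (a + u) ≠ halfCut (b + u)} :=
  (measurableSet_eq_fun (measurable_halfCut.comp (measurable_const_add a))
    (measurable_halfCut.comp (measurable_const_add b))).compl

/-- A periodic function has the same integral over every unit interval, so the separation
probability depends only on the difference of the two points. -/
theorem volume_halfCut_ne_shift (a t : ℝ) :
    (volume.restrict (Set.Ioc (0 : ℝ) 1)).real {u | halfCut (a + u) ≠ halfCut (a + t + u)} =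
    (volume.restrict (Set.Ioc (0 : ℝ) 1)).real {u | halfCut u ≠ halfCut (t + u)} := by
  set S : Set ℝ := {u | halfCut u ≠ halfCut (t + u)} with hS
  have hSm : MeasurableSet S := by
    have := measurableSet_halfCut_ne 0 t
    simp only [zero_add] at this
    exact this
  have hper : Function.Periodic (S.indicator fun _ => (1 : ℝ)) 1 := by
    intro u
    have : u + 1 ∈ S ↔ u ∈ S := by
      simp only [hS, Set.mem_ofPred_eq, ← add_assoc, halfCut_add_one]
    by_cases hu : u ∈ S <;> simp [hu, this]
  have key : ∀ T : Set ℝ, MeasurableSet T → (volume.restrict (Set.Ioc (0 : ℝ) 1)).real T =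
      ∫ u in (0 : ℝ)..1, T.indicator (fun _ => (1 : ℝ)) u := by
    intro T hT
    rw [intervalIntegral.integral_of_le zero_le_one, integral_indicator_const _ hT]
    simp
  have hT : {u | halfCut (a + u) ≠ halfCut (a + t + u)} = (fun u => a + u) ⁻¹' S := by
    ext u
    simp only [hS, Set.mem_ofPred_eq, Set.mem_preimage]
    rw [show a + t + u = t + (a + u) by ring]
  rw [hT, key _ (measurable_const_add a hSm), key _ hSm]
  have h1 : ∀ u, ((fun u => a + u) ⁻¹' S).indicator (fun _ => (1 : ℝ)) u =
      S.indicator (fun _ => (1 : ℝ)) (a + u) := fun u => rfl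
  simp_rw [h1]
  rw [intervalIntegral.integral_comp_add_left (fun u => S.indicator (fun _ => (1 : ℝ)) u) a]
  simpa using hper.intervalIntegral_add_eq a 0

/-- Moving by `t ≤ 1/2` crosses at most one cut point, so the separating shifts in `[0, 1)` are the
two intervals of length `t` ending at `1/2` and at `1`. -/
theorem volume_halfCut_ne_of_nonneg {t : ℝ} (h0 : 0 ≤ t) (h1 : t ≤ 1 / 2) :
    (volume.restrict (Set.Ioc (0 : ℝ) 1)).real {u | halfCut u ≠ halfCut (t + u)} = 2 * t := by
  have hS : MeasurableSet {u | halfCut u ≠ halfCut (t + u)} := by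
    have := measurableSet_halfCut_ne 0 t
    simp only [zero_add] at this
    exact this
  rw [← Measure.restrict_congr_set Ioo_ae_eq_Ioc, Measure.restrict_congr_set Ioo_ae_eq_Ico,
    measureReal_restrict_apply hS]
  have hset : {u | halfCut u ≠ halfCut (t + u)} ∩ Set.Ico (0 : ℝ) 1 =
      Set.Ico (1 / 2 - t) (1 / 2) ∪ Set.Ico (1 - t) 1 := by
    ext u
    simp only [Set.mem_inter_iff, Set.mem_ofPred_eq, Set.mem_union, Set.mem_Ico, halfCut, ne_eq,
      decide_eq_decide]
    by_cases hu : 0 ≤ u ∧ u < 1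
    · have hfu : Int.fract u = u := Int.fract_eq_self.2 hu
      rw [hfu]
      by_cases hut : t + u < 1
      · rw [Int.fract_eq_self.2 ⟨by linarith, hut⟩]
        grind
      · have : Int.fract (t + u) = t + u - 1 := by
          rw [Int.fract_eq_iff]
          exact ⟨by linarith, by linarith, 1, by push_cast; ring⟩
        rw [this]
        grind
    · grind
  rw [hset, measureReal_union ?_ measurableSet_Ico measure_Ico_lt_top.ne measure_Ico_lt_top.ne]
  · rw [Real.volume_real_Ico_of_le (by linarith), Real.volume_real_Ico_of_le (by linarith)]
    ring
  · rw [Set.Ico_disjoint_Ico]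
    simp; grind

/-- A uniformly shifted `halfCut` separates `a` and `b` with probability `2 * |a - b|` when `a` and
`b` are close. -/
theorem volume_halfCut_ne_of_le {a b : ℝ} (hab : |a - b| ≤ 1 / 2) :
    (volume.restrict (Set.Ioc (0 : ℝ) 1)).real {u | halfCut (a + u) ≠ halfCut (b + u)} =
      2 * |a - b| := by
  wlog h : a ≤ b generalizing a b
  · rw [abs_sub_comm, ← this (by rwa [abs_sub_comm]) (le_of_not_ge h)]
    simp_rw [ne_comm]
  · rw [abs_sub_comm, abs_of_nonneg (sub_nonneg.2 h)] at *
    rw [← volume_halfCut_ne_of_nonneg (sub_nonneg.2 h) hab,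
      ← volume_halfCut_ne_shift a (b - a)]
    simp

/-- Beyond distance `1/2` the bound exceeds `1` and is trivial. -/
theorem volume_halfCut_ne_le (a b : ℝ) :
    (volume.restrict (Set.Ioc (0 : ℝ) 1)).real {u | halfCut (a + u) ≠ halfCut (b + u)} ≤
      2 * |a - b| := by
  by_cases hab : |a - b| ≤ 1 / 2
  · exact (volume_halfCut_ne_of_le hab).le
  · have : IsProbabilityMeasure (volume.restrict (Set.Ioc (0 : ℝ) 1)) := ⟨by simp⟩
    refine measureReal_le_one.trans ?_
    linarith [not_le.1 hab]

/-- The uniform distribution on the unit interval. -/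
noncomputable def unitUniform : Measure ℝ := volume.restrict (Set.Ioc (0 : ℝ) 1)

instance : IsProbabilityMeasure unitUniform := ⟨by simp [unitUniform]⟩

theorem measurable_halfCut_add {Ω : Type*} [MeasurableSpace Ω] {g : Ω → ℝ} (hg : Measurable g) :
    Measurable fun z : Ω × ℝ => halfCut (g z.1 + z.2) :=
  measurable_halfCut.comp ((hg.comp measurable_fst).add measurable_snd)

theorem measureReal_halfCut_ne_eq_integral {Ω : Type*} [MeasurableSpace Ω] (P : Measure Ω)
    [IsProbabilityMeasure P] {g₁ g₂ : Ω → ℝ} (h₁ : Measurable g₁) (h₂ : Measurable g₂) :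
    Integrable (fun ω => unitUniform.real {u | halfCut (g₁ ω + u) ≠ halfCut (g₂ ω + u)}) P ∧
    (P.prod unitUniform).real {z | halfCut (g₁ z.1 + z.2) ≠ halfCut (g₂ z.1 + z.2)} =
      ∫ ω, unitUniform.real {u | halfCut (g₁ ω + u) ≠ halfCut (g₂ ω + u)} ∂P := by
  have hS : MeasurableSet {z : Ω × ℝ | halfCut (g₁ z.1 + z.2) ≠ halfCut (g₂ z.1 + z.2)} :=
    (measurableSet_eq_fun (measurable_halfCut_add h₁) (measurable_halfCut_add h₂)).compl
  have hmeas := measurable_measure_prodMk_left (ν := unitUniform) hS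
  constructor
  · refine Integrable.of_bound (C := 1) hmeas.ennreal_toReal.aestronglyMeasurable
      (Filter.Eventually.of_forall fun ω => ?_)
    rw [Real.norm_of_nonneg measureReal_nonneg]
    exact measureReal_le_one
  · rw [Measure.real, Measure.prod_apply hS]
    exact (integral_toReal hmeas.aemeasurable
      (Filter.Eventually.of_forall fun ω => measure_lt_top _ _)).symm

theorem measureReal_halfCut_ne_le {Ω : Type*} [MeasurableSpace Ω] (P : Measure Ω)
    [IsProbabilityMeasure P] {g₁ g₂ : Ω → ℝ} (h₁ : Measurable g₁) (h₂ : Measurable g₂)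
    (hint : Integrable (fun ω => |g₁ ω - g₂ ω|) P) :
    (P.prod unitUniform).real {z | halfCut (g₁ z.1 + z.2) ≠ halfCut (g₂ z.1 + z.2)} ≤
      2 * ∫ ω, |g₁ ω - g₂ ω| ∂P := by
  obtain ⟨hi, he⟩ := measureReal_halfCut_ne_eq_integral P h₁ h₂
  rw [he, ← integral_const_mul]
  exact integral_mono hi (hint.const_mul 2) fun ω => volume_halfCut_ne_le _ _

/-- Conditionally on `ω` only the shift is random. Where the projections differ by at most `1/2` the
conditional probability is exact; elsewhere it is bounded below by `0`. -/
theorem le_measureReal_halfCut_ne {Ω : Type*} [MeasurableSpace Ω] (P : Measure Ω)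
    [IsProbabilityMeasure P] {g₁ g₂ : Ω → ℝ} (h₁ : Measurable g₁) (h₂ : Measurable g₂)
    (hint : Integrable (fun ω => |g₁ ω - g₂ ω|) P) :
    2 * ∫ ω in {ω | |g₁ ω - g₂ ω| ≤ 1 / 2}, |g₁ ω - g₂ ω| ∂P ≤
    (P.prod unitUniform).real {z | halfCut (g₁ z.1 + z.2) ≠ halfCut (g₂ z.1 + z.2)} := by
  obtain ⟨hi, he⟩ := measureReal_halfCut_ne_eq_integral P h₁ h₂
  have hm : MeasurableSet {ω | |g₁ ω - g₂ ω| ≤ 1 / 2} :=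
    measurableSet_le (measurable_abs.comp (h₁.sub h₂)) measurable_const
  rw [he, ← integral_const_mul, ← integral_indicator hm]
  refine integral_mono ((hint.const_mul 2).indicator hm) hi fun ω => ?_
  by_cases hω : ω ∈ {ω | |g₁ ω - g₂ ω| ≤ 1 / 2}
  · rw [Set.indicator_of_mem hω]
    exact (volume_halfCut_ne_of_le hω).ge
  · rw [Set.indicator_of_notMem hω]
    exact measureReal_nonneg

/-! ### Existence of symmetric stable laws -/

open Filter Topology in
/-- Lévy's continuity theorem: a pointwise limit of characteristic functions that is continuous
at `0` is a characteristic function. -/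
theorem exists_probabilityMeasure_charFun_eq {μ : ℕ → Measure ℝ}
    [∀ i, IsProbabilityMeasure (μ i)] {f : ℝ → ℂ} (hf : ContinuousAt f 0)
    (h : ∀ t, Tendsto (fun n => charFun (μ n) t) atTop (𝓝 (f t))) :
    ∃ ν : Measure ℝ, IsProbabilityMeasure ν ∧ ∀ t, charFun ν t = f t := by
  have htight := isTightMeasureSet_of_tendsto_charFun hf h
  set M : ℕ → ProbabilityMeasure ℝ := fun n => ⟨μ n, inferInstance⟩ with hM
  have hcomp : IsCompact (closure (Set.range M)) := by
    refine isCompact_closure_of_isTightMeasureSet ?_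
    convert htight using 1
    ext ρ
    constructor
    · rintro ⟨_, ⟨n, rfl⟩, rfl⟩
      exact ⟨n, rfl⟩
    · rintro ⟨n, rfl⟩
      exact ⟨_, ⟨n, rfl⟩, rfl⟩
  -- Tightness gives relative compactness, and a limit along an ultrafilter replaces the choice of a
  -- convergent subsequence.
  set U : Ultrafilter ℕ := Ultrafilter.of atTop with hU
  obtain ⟨ν, -, hν⟩ := hcomp.ultrafilter_le_nhds (U.map M)
    (.trans (by simp) (monotone_principal subset_closure))
  refine ⟨ν, inferInstance, fun t => ?_⟩
  have hν' : Tendsto M U (𝓝 ν) := hν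
  rw [ProbabilityMeasure.tendsto_iff_forall_integral_rclike_tendsto ℂ] at hν'
  have h1 := hν' (BoundedContinuousFunction.innerProbChar t)
  simp_rw [← charFun_eq_integral_innerProbChar] at h1
  exact tendsto_nhds_unique h1 ((h t).mono_left (Ultrafilter.of_le atTop))

/-- The total mass of the jump kernel of the symmetric stable law, at frequency `1`. -/
theorem integrableOn_one_sub_cos_mul_rpow {p : ℝ} (h0 : 0 < p) (h2 : p < 2) :
    IntegrableOn (fun z : ℝ => (1 - Real.cos z) * z ^ (-(p + 1))) (Set.Ioi 0) := by
  have hmeas : Measurable fun z : ℝ => (1 - Real.cos z) * z ^ (-(p + 1)) := by fun_prop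
  rw [← Set.Ioc_union_Ioi_eq_Ioi zero_le_one]
  refine IntegrableOn.union ?_ ?_
  · have h1 : IntegrableOn (fun z : ℝ => z ^ (1 - p)) (Set.Ioc 0 1) := by
      rw [← intervalIntegrable_iff_integrableOn_Ioc_of_le zero_le_one]
      exact intervalIntegral.intervalIntegrable_rpow' (by linarith)
    refine Integrable.mono' h1 hmeas.aestronglyMeasurable
      ((ae_restrict_iff' measurableSet_Ioc).2 (Filter.Eventually.of_forall fun z hz => ?_))
    have hz0 : 0 < z := hz.1
    have hc : 0 ≤ 1 - Real.cos z := sub_nonneg.2 (Real.cos_le_one z)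
    rw [Real.norm_of_nonneg (by positivity)]
    have h3 : 1 - Real.cos z ≤ z ^ (2 : ℝ) := by
      have := Real.one_sub_sq_div_two_le_cos (x := z)
      rw [Real.rpow_two]
      nlinarith [sq_nonneg z]
    calc (1 - Real.cos z) * z ^ (-(p + 1)) ≤ z ^ (2 : ℝ) * z ^ (-(p + 1)) := by gcongr
      _ = z ^ (1 - p) := by rw [← Real.rpow_add hz0]; ring_nf
  · refine Integrable.mono' ((integrableOn_Ioi_rpow_of_lt (a := -(p + 1)) (by linarith)
      one_pos).const_mul 2) hmeas.aestronglyMeasurable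
      ((ae_restrict_iff' measurableSet_Ioi).2 (Filter.Eventually.of_forall fun z hz => ?_))
    have hz0 : 0 < z := one_pos.trans hz
    have hc : 0 ≤ 1 - Real.cos z := sub_nonneg.2 (Real.cos_le_one z)
    rw [Real.norm_of_nonneg (by positivity)]
    gcongr
    linarith [Real.neg_one_le_cos z]

theorem one_sub_cos_mul_rpow_scale {p b z : ℝ} (hb : 0 < b) (hz : 0 < z) :
    (1 - Real.cos (b * z)) * z ^ (-(p + 1)) =
      b ^ (p + 1) * ((1 - Real.cos (b * z)) * (b * z) ^ (-(p + 1))) := by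
  rw [Real.mul_rpow hb.le hz.le, Real.rpow_neg hb.le]
  have := Real.rpow_pos_of_pos hb (p + 1)
  field_simp

theorem integrableOn_one_sub_cos_mul_left_mul_rpow {p : ℝ} (h0 : 0 < p) (h2 : p < 2) (t : ℝ) :
    IntegrableOn (fun z : ℝ => (1 - Real.cos (t * z)) * z ^ (-(p + 1))) (Set.Ioi 0) := by
  rcases eq_or_ne t 0 with rfl | ht
  · simp
  have hb : 0 < |t| := abs_pos.2 ht
  have h1 : IntegrableOn (fun z : ℝ => |t| ^ (p + 1) *
      ((1 - Real.cos (|t| * z)) * (|t| * z) ^ (-(p + 1)))) (Set.Ioi 0) := by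
    refine Integrable.const_mul ?_ _
    have := (integrableOn_Ioi_comp_mul_left_iff
      (fun z : ℝ => (1 - Real.cos z) * z ^ (-(p + 1))) 0 hb).2
      (by simpa using integrableOn_one_sub_cos_mul_rpow h0 h2)
    exact this
  refine h1.congr_fun (fun z hz => ?_) measurableSet_Ioi
  have hcos : Real.cos (t * z) = Real.cos (|t| * z) := by
    rcases abs_choice t with h | h <;> simp [h]
  simp only
  rw [hcos, one_sub_cos_mul_rpow_scale hb hz]

/-- The substitution `z ↦ |t| z` rescales the kernel `z^(-(p+1)) dz` by `|t|^p`; this is the source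
of the stable exponent. -/
theorem integral_one_sub_cos_mul_left_mul_rpow {p : ℝ} (h0 : 0 < p) (t : ℝ) :
    ∫ z in Set.Ioi (0 : ℝ), (1 - Real.cos (t * z)) * z ^ (-(p + 1)) =
      |t| ^ p * ∫ z in Set.Ioi (0 : ℝ), (1 - Real.cos z) * z ^ (-(p + 1)) := by
  rcases eq_or_ne t 0 with rfl | ht
  · simp [h0.ne']
  have hb : 0 < |t| := abs_pos.2 ht
  have hcos : ∀ z, Real.cos (t * z) = Real.cos (|t| * z) := fun z => by
    rcases abs_choice t with h | h <;> simp [h]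
  simp_rw [hcos]
  rw [setIntegral_congr_fun measurableSet_Ioi
    (fun z hz => one_sub_cos_mul_rpow_scale (p := p) hb hz), integral_const_mul,
    integral_comp_mul_left_Ioi (fun z => (1 - Real.cos z) * z ^ (-(p + 1))) 0 hb,
    mul_zero, smul_eq_mul, ← mul_assoc, Real.rpow_add hb, Real.rpow_one,
    mul_assoc (|t| ^ p), mul_inv_cancel₀ hb.ne', mul_one]

/-- The integrand is nonnegative, and positive on `(0, 1)`. This makes the constant of the stable
law positive. -/
theorem integral_one_sub_cos_mul_rpow_pos {p : ℝ} (h0 : 0 < p) (h2 : p < 2) :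
    0 < ∫ z in Set.Ioi (0 : ℝ), (1 - Real.cos z) * z ^ (-(p + 1)) := by
  have hsub : Set.Ioc (0 : ℝ) 1 ⊆ Set.Ioi 0 := fun z hz => hz.1
  have hint := integrableOn_one_sub_cos_mul_rpow h0 h2
  have h1 : 0 < ∫ z in (0 : ℝ)..1, (1 - Real.cos z) * z ^ (-(p + 1)) := by
    refine intervalIntegral.intervalIntegral_pos_of_pos_on
      ((intervalIntegrable_iff_integrableOn_Ioc_of_le zero_le_one).2 (hint.mono_set hsub))
      (fun z hz => ?_) one_pos
    have : Real.cos z < 1 := by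
      rw [← Real.cos_zero]
      exact Real.cos_lt_cos_of_nonneg_of_le_pi le_rfl
        (by linarith [hz.2, Real.pi_gt_three]) hz.1
    exact mul_pos (sub_pos.2 this) (Real.rpow_pos_of_pos hz.1 _)
  rw [intervalIntegral.integral_of_le zero_le_one] at h1
  refine h1.trans_le (setIntegral_mono_set hint
    ((ae_restrict_iff' measurableSet_Ioi).2 (Filter.Eventually.of_forall fun z hz => ?_))
    hsub.eventuallyLE)
  exact mul_nonneg (sub_nonneg.2 (Real.cos_le_one z)) (Real.rpow_nonneg (le_of_lt hz) _)

-- The Pareto density is the jump kernel cut off below `e` and normalised to mass one.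
open ProbabilityTheory in
theorem integral_one_sub_cos_paretoMeasure {p e : ℝ} (h0 : 0 < p) (he : 0 < e) (t : ℝ) :
    ∫ z, (1 - Real.cos (t * z)) ∂(paretoMeasure e p) =
      p * e ^ p * ∫ z in Set.Ioi e, (1 - Real.cos (t * z)) * z ^ (-(p + 1)) := by
  rw [paretoMeasure, integral_withDensity_eq_integral_toReal_smul₀
    (by exact (measurable_paretoPDFReal e p).ennreal_ofReal.aemeasurable)
    (Filter.Eventually.of_forall fun z => by simp [paretoPDF]), ← integral_Ici_eq_integral_Ioi,
    ← integral_const_mul, ← integral_indicator measurableSet_Ici]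
  refine integral_congr_ae (Filter.Eventually.of_forall fun z => ?_)
  simp only [paretoPDF, smul_eq_mul]
  rw [ENNReal.toReal_ofReal (paretoPDFReal_nonneg he.le h0.le z), paretoPDFReal]
  by_cases hz : e ≤ z
  · rw [if_pos hz, Set.indicator_of_mem (show z ∈ Set.Ici e from hz)]
    ring
  · rw [if_neg hz, Set.indicator_of_notMem (show z ∉ Set.Ici e from hz), zero_mul]

/-- The symmetrization of a probability measure has as characteristic function the integral of
the cosine. -/
theorem exists_probabilityMeasure_charFun_eq_integral_cos (μ : Measure ℝ)
    [IsProbabilityMeasure μ] :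
    ∃ ν : Measure ℝ, IsProbabilityMeasure ν ∧
      ∀ t, charFun ν t = ((∫ z, Real.cos (t * z) ∂μ : ℝ) : ℂ) := by
  have hneg : IsProbabilityMeasure (μ.map fun z => (-1 : ℝ) * z) :=
    Measure.isProbabilityMeasure_map (by fun_prop)
  refine ⟨(2⁻¹ : ENNReal) • μ + (2⁻¹ : ENNReal) • μ.map (fun z => (-1 : ℝ) * z),
    ⟨by
      rw [Measure.add_apply, Measure.smul_apply, Measure.smul_apply, measure_univ, measure_univ]
      simp [ENNReal.inv_two_add_inv_two]⟩, fun t => ?_⟩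
  have hi : ∀ (ρ : Measure ℝ) [IsProbabilityMeasure ρ],
      Integrable (fun x : ℝ => Complex.exp (t * x * Complex.I)) ρ := by
    intro ρ _
    refine Integrable.of_bound (C := 1) (by fun_prop) (Filter.Eventually.of_forall fun x => ?_)
    rw [← Complex.ofReal_mul, Complex.norm_exp_ofReal_mul_I]
  have hcos : Integrable (fun z => Real.cos (t * z)) μ :=
    Integrable.of_bound (C := 1) (by fun_prop)
      (Filter.Eventually.of_forall fun x => Real.abs_cos_le_one _)
  have h1 : charFun (μ.map fun z => (-1 : ℝ) * z) t =
      ∫ x, Complex.exp (-(t * x * Complex.I)) ∂μ := by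
    rw [charFun_map_mul, charFun_apply_real]
    congr 1 with x
    push_cast; ring_nf
  have hi' : Integrable (fun x : ℝ => Complex.exp (-(t * x * Complex.I))) μ := by
    refine Integrable.of_bound (C := 1) (by fun_prop) (Filter.Eventually.of_forall fun x => ?_)
    rw [← neg_mul, ← Complex.ofReal_mul, ← Complex.ofReal_neg, Complex.norm_exp_ofReal_mul_I]
  rw [charFun_apply_real, integral_add_measure ((hi μ).smul_measure (by simp))
    ((hi _).smul_measure (by simp)), integral_smul_measure, integral_smul_measure,
    ← charFun_apply_real, ← charFun_apply_real, h1, charFun_apply_real, ← smul_add,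
    ← integral_add (hi μ) hi', ← integral_complex_ofReal, ← integral_smul]
  congr 1 with x
  rw [Complex.ofReal_cos, Complex.cos]
  simp
  ring_nf

open Filter Topology ProbabilityTheory in
/-- For `0 < p < 2` there is a symmetric `p`-stable law. -/
theorem exists_stable_of_lt_two {p : ℝ} (h0 : 0 < p) (h2 : p < 2) :
    ∃ (ν : Measure ℝ) (c : ℝ), IsProbabilityMeasure ν ∧ 0 < c ∧
      ∀ t : ℝ, charFun ν t = ((Real.exp (-(c * |t| ^ p)) : ℝ) : ℂ) := by
  set I := ∫ z in Set.Ioi (0 : ℝ), (1 - Real.cos z) * z ^ (-(p + 1)) with hI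
  have hIpos : 0 < I := integral_one_sub_cos_mul_rpow_pos h0 h2
  -- The cutoff satisfies `e n ^ p = 1 / (n + 1)`, so each of the `n + 1` summands below carries a
  -- `1 / (n + 1)` share of the exponent while the cutoff tends to `0`.
  set e : ℕ → ℝ := fun n => ((n : ℝ) + 1) ^ (-p⁻¹) with he
  have hepos : ∀ n, 0 < e n := fun n => by positivity
  have hep : ∀ n, e n ^ p = ((n : ℝ) + 1)⁻¹ := fun n => by
    rw [he, ← Real.rpow_mul (by positivity), neg_mul, inv_mul_cancel₀ h0.ne', Real.rpow_neg_one]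
  have hprob : ∀ n, IsProbabilityMeasure (paretoMeasure (e n) p) := fun n =>
    isProbabilityMeasure_paretoMeasure (hepos n) h0
  have hsym : ∀ n, ∃ ν : Measure ℝ, IsProbabilityMeasure ν ∧
      ∀ t, charFun ν t = ((∫ z, Real.cos (t * z) ∂(paretoMeasure (e n) p) : ℝ) : ℂ) := fun n =>
    exists_probabilityMeasure_charFun_eq_integral_cos _
  choose ν hν hνc using hsym
  set σ : ℕ → Measure ℝ := fun n =>
    (Measure.pi fun _ : Fin (n + 1) => ν n).map (fun x => ∑ i, x i) with hσ
  have hσp : ∀ n, IsProbabilityMeasure (σ n) := fun n =>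
    Measure.isProbabilityMeasure_map (by fun_prop)
  have hcos : ∀ n t, ∫ z, Real.cos (t * z) ∂(paretoMeasure (e n) p) =
      1 + -(p * ((n : ℝ) + 1)⁻¹ *
        ∫ z in Set.Ioi (e n), (1 - Real.cos (t * z)) * z ^ (-(p + 1))) := by
    intro n t
    have h1 := integral_one_sub_cos_paretoMeasure h0 (hepos n) t
    rw [integral_sub (integrable_const _) (Integrable.of_bound (C := 1) (by fun_prop)
      (Filter.Eventually.of_forall fun x => Real.abs_cos_le_one _)), hep] at h1
    simp only [integral_const, probReal_univ, one_smul] at h1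
    linarith
  have hσc : ∀ n t, charFun (σ n) t = (((1 + -(p * ((n : ℝ) + 1)⁻¹ *
        ∫ z in Set.Ioi (e n), (1 - Real.cos (t * z)) * z ^ (-(p + 1)))) ^ (n + 1) : ℝ) : ℂ) := by
    intro n t
    rw [hσ]
    simp only
    rw [charFun_map_sum_pi_eq_prod]
    simp [hνc, hcos]
  have he0 : Tendsto e atTop (𝓝 0) :=
    (tendsto_rpow_neg_atTop (inv_pos.2 h0)).comp
      (tendsto_atTop_add_const_right _ _ tendsto_natCast_atTop_atTop)
  have hlim : ∀ t, Tendsto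
      (fun n => ∫ z in Set.Ioi (e n), (1 - Real.cos (t * z)) * z ^ (-(p + 1))) atTop
      (𝓝 (|t| ^ p * I)) := by
    intro t
    rw [hI, ← integral_one_sub_cos_mul_left_mul_rpow h0 t]
    have hcov := (aecover_Ioi_of_Ioi (μ := volume) (A := (0 : ℝ)) he0)
    have h1 := hcov.integral_tendsto_of_countably_generated
      (integrableOn_one_sub_cos_mul_left_mul_rpow h0 h2 t)
    refine h1.congr fun n => ?_
    rw [Measure.restrict_restrict measurableSet_Ioi, Set.inter_eq_left.2
      (Set.Ioi_subset_Ioi (hepos n).le)]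
  have hfin : ∀ t, Tendsto (fun n => charFun (σ n) t) atTop
      (𝓝 ((Real.exp (-(p * I * |t| ^ p)) : ℝ) : ℂ)) := by
    intro t
    simp_rw [hσc]
    refine (Complex.continuous_ofReal.tendsto _).comp ?_
    -- Indexed by the number `m = n + 1` of summands, to fit the limit of `(1 + g m) ^ m`; hence the
    -- `m - 1`.
    set g : ℕ → ℝ := fun m => -(p * (m : ℝ)⁻¹ *
      ∫ z in Set.Ioi (e (m - 1)), (1 - Real.cos (t * z)) * z ^ (-(p + 1))) with hg
    have hgl : Tendsto (fun m : ℕ => (m : ℝ) * g m) atTop (𝓝 (-(p * I * |t| ^ p))) := by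
      rw [← tendsto_add_atTop_iff_nat 1]
      have := ((hlim t).const_mul p).neg
      rw [show p * I * |t| ^ p = p * (|t| ^ p * I) by ring]
      refine this.congr fun n => ?_
      simp only [hg, Nat.add_sub_cancel, Nat.cast_add, Nat.cast_one]
      have : (n : ℝ) + 1 ≠ 0 := by positivity
      field_simp
    have := (Real.tendsto_one_add_pow_exp_of_tendsto hgl).comp (tendsto_add_atTop_nat 1)
    refine this.congr fun n => ?_
    simp [hg]
  have hcont : ContinuousAt (fun t : ℝ => ((Real.exp (-(p * I * |t| ^ p)) : ℝ) : ℂ)) 0 := by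
    refine Continuous.continuousAt ?_
    have : Continuous fun t : ℝ => |t| ^ p :=
      continuous_abs.rpow_const fun _ => Or.inr h0.le
    fun_prop
  obtain ⟨ρ, hρ, hρc⟩ := exists_probabilityMeasure_charFun_eq hcont hfin
  exact ⟨ρ, p * I, hρ, by positivity, hρc⟩

/-- For `0 < p ≤ 2` there is a symmetric `p`-stable law. -/
theorem exists_stable {p : ℝ} (h0 : 0 < p) (h2 : p ≤ 2) :
    ∃ (ν : Measure ℝ) (c : ℝ), IsProbabilityMeasure ν ∧ 0 < c ∧
      ∀ t : ℝ, charFun ν t = ((Real.exp (-(c * |t| ^ p)) : ℝ) : ℂ) := by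
  rcases h2.lt_or_eq with h | rfl
  · exact exists_stable_of_lt_two h0 h
  -- At `p = 2` the kernel integral diverges at `0`; the standard Gaussian takes over.
  · refine ⟨ProbabilityTheory.gaussianReal 0 1, 1 / 2, inferInstance, by norm_num, fun t => ?_⟩
    rw [ProbabilityTheory.charFun_gaussianReal]
    push_cast
    congr 1
    rw [Real.rpow_two, sq_abs]
    push_cast
    simp
    ring

/-! ### First moments and stable projections -/

/-- A symmetric `p`-stable law with `p > 1` has a first moment. -/
theorem integrable_abs_of_charFun_eq_stable {p c : ℝ} (hp : 1 < p) (hc : 0 < c) (ν : Measure ℝ)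
    [IsProbabilityMeasure ν]
    (hν : ∀ t : ℝ, charFun ν t = ((Real.exp (-(c * |t| ^ p)) : ℝ) : ℂ)) :
    Integrable (fun x : ℝ => |x|) ν := by
  have hp0 : 0 < p := by linarith
  -- The tail beyond `r` is controlled by `1 - charFun` on `|t| ≤ 2/r`, where it is at most
  -- `c|t|^p`.
  have htail : ∀ r : ℝ, 0 < r → ν.real {x | r < |x|} ≤ 2 * c * 2 ^ p * r ^ (-p) := by
    intro r hr
    refine (measureReal_abs_gt_le_integral_charFun hr).trans ?_
    have h1 : ‖∫ t in (-2 * r⁻¹)..(2 * r⁻¹), 1 - charFun ν t‖ ≤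
        c * (2 * r⁻¹) ^ p * |2 * r⁻¹ - -2 * r⁻¹| := by
      refine intervalIntegral.norm_integral_le_of_norm_le_const fun t ht => ?_
      have hr' : 0 < r⁻¹ := inv_pos.2 hr
      rw [Set.uIoc_of_le (by linarith)] at ht
      have habs : |t| ≤ 2 * r⁻¹ := abs_le.2 ⟨by linarith [ht.1], ht.2⟩
      have h0 : 0 ≤ c * |t| ^ p := by positivity
      rw [hν, ← Complex.ofReal_one, ← Complex.ofReal_sub, Complex.norm_real, Real.norm_of_nonneg
        (sub_nonneg.2 (Real.exp_le_one_iff.2 (by linarith)))]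
      calc 1 - Real.exp (-(c * |t| ^ p)) ≤ c * |t| ^ p := by
            linarith [Real.add_one_le_exp (-(c * |t| ^ p))]
        _ ≤ c * (2 * r⁻¹) ^ p := by gcongr
    calc 2⁻¹ * r * ‖∫ t in (-2 * r⁻¹)..(2 * r⁻¹), 1 - charFun ν t‖
        ≤ 2⁻¹ * r * (c * (2 * r⁻¹) ^ p * |2 * r⁻¹ - -2 * r⁻¹|) := by gcongr
      _ = 2 * c * 2 ^ p * r ^ (-p) := by
        rw [show 2 * r⁻¹ - -2 * r⁻¹ = 4 * r⁻¹ by ring, abs_of_pos (by positivity),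
          Real.mul_rpow (by norm_num) (by positivity), Real.inv_rpow hr.le, Real.rpow_neg hr.le]
        field_simp
        norm_num
  refine ⟨by fun_prop, ?_⟩
  -- Layer-cake formula: the tail `t^(-p)` is integrable on `(1, ∞)` because `p > 1`.
  rw [hasFiniteIntegral_iff_ofReal (Filter.Eventually.of_forall fun x => abs_nonneg x),
    lintegral_eq_lintegral_meas_lt ν (Filter.Eventually.of_forall fun x => abs_nonneg x)
      (by fun_prop), ← Set.Ioc_union_Ioi_eq_Ioi zero_le_one]
  refine (lintegral_union_le _ _ _).trans_lt (ENNReal.add_lt_top.2 ⟨?_, ?_⟩)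
  · calc ∫⁻ t in Set.Ioc (0 : ℝ) 1, ν {a | t < |a|} ≤ ∫⁻ _ in Set.Ioc (0 : ℝ) 1, 1 :=
          lintegral_mono fun t => prob_le_one
      _ < ⊤ := by simp
  · have hint : IntegrableOn (fun t : ℝ => 2 * c * 2 ^ p * t ^ (-p)) (Set.Ioi 1) :=
      (integrableOn_Ioi_rpow_of_lt (by linarith) one_pos).const_mul _
    refine lt_of_le_of_lt ?_ hint.lintegral_lt_top
    refine setLIntegral_mono' measurableSet_Ioi fun t ht => ?_
    rw [← ofReal_measureReal]
    exact ENNReal.ofReal_le_ofReal (htail t (one_pos.trans ht))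

/-- A zero first moment would force `ν` to be the point mass at `0`, whose characteristic function
at `1` is `1`, not `e^(-c)`. -/
theorem integral_abs_pos_of_charFun_eq_stable {p c : ℝ} (hc : 0 < c) (ν : Measure ℝ)
    [IsProbabilityMeasure ν] (hint : Integrable (fun x : ℝ => |x|) ν)
    (hν : ∀ t : ℝ, charFun ν t = ((Real.exp (-(c * |t| ^ p)) : ℝ) : ℂ)) :
    0 < ∫ x, |x| ∂ν := by
  refine (integral_nonneg fun x => abs_nonneg x).lt_of_ne fun h => ?_
  have h0 := (integral_eq_zero_iff_of_nonneg (fun x => abs_nonneg x) hint).1 h.symm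
  have h1 : charFun ν 1 = 1 := by
    rw [charFun_apply_real, integral_congr_ae (g := fun _ => (1 : ℂ))]
    · simp
    · filter_upwards [h0] with x hx
      simp [abs_eq_zero.1 hx]
  rw [hν, ← Complex.ofReal_one, Complex.ofReal_inj, Real.exp_eq_one_iff] at h1
  simp at h1
  linarith

-- The truncated moments increase to the full one as the level grows.
open Filter Topology in
theorem exists_half_integral_abs_le {ν : Measure ℝ} (hint : Integrable (fun x : ℝ => |x|) ν)
    (hpos : 0 < ∫ x, |x| ∂ν) :
    ∃ K : ℝ, 0 < K ∧ (∫ x, |x| ∂ν) / 2 ≤ ∫ x in {x | |x| ≤ K}, |x| ∂ν := by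
  have h1 : Tendsto (fun n : ℕ => ∫ x in {x : ℝ | |x| ≤ n}, |x| ∂ν) atTop
      (𝓝 (∫ x in ⋃ n : ℕ, {x : ℝ | |x| ≤ n}, |x| ∂ν)) := by
    refine tendsto_setIntegral_of_monotone
      (fun n => measurableSet_le measurable_abs measurable_const) (fun m n hmn x hx => ?_)
      hint.integrableOn
    exact le_trans (show |x| ≤ m from hx) (by exact_mod_cast hmn)
  have h2 : ⋃ n : ℕ, {x : ℝ | |x| ≤ n} = Set.univ :=
    Set.eq_univ_of_forall fun x => Set.mem_iUnion.2 (exists_nat_ge |x|)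
  rw [h2, setIntegral_univ] at h1
  obtain ⟨n, hn1, hn2⟩ := ((h1.eventually_const_le (half_lt_self hpos)).and
    (eventually_gt_atTop 0)).exists
  exact ⟨n, by exact_mod_cast hn2, hn1⟩

/-- The defining property of stable laws: a linear combination of independent stable variables is a
multiple of one of them, the factor being the `ℓ_p` norm of the coefficients. -/
theorem map_sum_mul_pi_stable {p c : ℝ} (hp : 0 < p) (ν : Measure ℝ)
    [IsProbabilityMeasure ν]
    (hν : ∀ t : ℝ, charFun ν t = ((Real.exp (-(c * |t| ^ p)) : ℝ) : ℂ)) {d : ℕ}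
    (x : Fin d → ℝ) :
    (Measure.pi fun _ : Fin d => ν).map (fun θ => ∑ i, x i * θ i) =
      ν.map fun s => (∑ i, |x i| ^ p) ^ (1 / p) * s := by
  have hprob : ∀ i, IsProbabilityMeasure (ν.map fun s => x i * s) := fun i =>
    Measure.isProbabilityMeasure_map (by fun_prop)
  have h1 : (Measure.pi fun _ : Fin d => ν).map (fun θ => ∑ i, x i * θ i) =
      (Measure.pi fun i => ν.map fun s => x i * s).map (fun θ => ∑ i, θ i) := by
    rw [← Measure.pi_map_pi (f := fun i s => x i * s) (fun i => by fun_prop),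
      Measure.map_map (by fun_prop) (by fun_prop)]
    rfl
  have hprob1 : IsProbabilityMeasure
      ((Measure.pi fun _ : Fin d => ν).map (fun θ => ∑ i, x i * θ i)) :=
    Measure.isProbabilityMeasure_map (Measurable.aemeasurable (by fun_prop))
  have hprob2 : IsProbabilityMeasure (ν.map fun s => (∑ i, |x i| ^ p) ^ (1 / p) * s) :=
    Measure.isProbabilityMeasure_map (by fun_prop)
  -- Both characteristic functions equal `exp(-c (∑ |x i|^p) |t|^p)`.
  refine Measure.ext_of_charFun (funext fun t => ?_)
  have hS : 0 ≤ ∑ i, |x i| ^ p := by positivity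
  rw [h1, ProbabilityTheory.charFun_map_sum_pi_eq_prod, Finset.prod_apply]
  simp_rw [charFun_map_mul, hν]
  rw [← Complex.ofReal_prod, ← Real.exp_sum, Finset.sum_neg_distrib, ← Finset.mul_sum,
    abs_mul, abs_of_nonneg (Real.rpow_nonneg hS _), Real.mul_rpow (by positivity) (abs_nonneg t),
    ← Real.rpow_mul hS, one_div, inv_mul_cancel₀ hp.ne', Real.rpow_one, Finset.sum_mul]
  simp_rw [abs_mul, Real.mul_rpow (abs_nonneg _) (abs_nonneg t)]

/-- A random linear functional whose truncated first absolute moments are governed by the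
`ℓ_p` norm. -/
theorem exists_stable_projection {p : ℝ} (hp : 1 < p) (hp2 : p ≤ 2) :
    ∃ (ν : Measure ℝ) (K : ℝ), IsProbabilityMeasure ν ∧ 0 < K ∧
      Integrable (fun x : ℝ => |x|) ν ∧ 0 < ∫ x, |x| ∂ν ∧
      (∫ x, |x| ∂ν) / 2 ≤ ∫ x in {x | |x| ≤ K}, |x| ∂ν ∧
      ∀ (d : ℕ) (x y : Fin d → ℝ),
        (Measure.pi fun _ : Fin d => ν).map (fun θ => ∑ i, (x i - y i) * θ i) =
          ν.map fun s => lpDist p x y * s := by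
  have hp0 : 0 < p := by linarith
  obtain ⟨ν, c, hνp, hc, hν⟩ := exists_stable hp0 hp2
  have hint := integrable_abs_of_charFun_eq_stable hp hc ν hν
  have hpos := integral_abs_pos_of_charFun_eq_stable hc ν hint hν
  obtain ⟨K, hK, hKM⟩ := exists_half_integral_abs_le hint hpos
  refine ⟨ν, K, hνp, hK, hint, hpos, hKM, fun d x y => ?_⟩
  rw [lpDist_eq hp0]
  exact map_sum_mul_pi_stable hp0 ν hν fun i => x i - y i

/-! ### Distances in finite sets and degenerate cases -/

theorem lpDist_self {d : ℕ} {p : ℝ} (hp : 0 < p) (x : Fin d → ℝ) : lpDist p x x = 0 := by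
  rw [lpDist_eq hp]; simp [hp.ne']

theorem lpDist_pos {d : ℕ} {p : ℝ} (hp : 0 < p) {x y : Fin d → ℝ} (hxy : x ≠ y) :
    0 < lpDist p x y := by
  rw [lpDist_eq hp]
  obtain ⟨i, hi⟩ := Function.ne_iff.1 hxy
  have h1 : 0 < |x i - y i| ^ p := Real.rpow_pos_of_pos (abs_pos.2 (sub_ne_zero.2 hi)) _
  have h2 : |x i - y i| ^ p ≤ ∑ i, |x i - y i| ^ p :=
    Finset.single_le_sum (f := fun i => |x i - y i| ^ p) (fun i _ => by positivity)
      (Finset.mem_univ i)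
  exact Real.rpow_pos_of_pos (h1.trans_le h2) _

theorem lpDist_le_lpMaxDist {d : ℕ} {p : ℝ} {X : Finset (Fin d → ℝ)} {x y : Fin d → ℝ}
    (hx : x ∈ X) (hy : y ∈ X) : lpDist p x y ≤ lpMaxDist p X := by
  refine le_csSup (Set.Finite.bddAbove ?_) ⟨x, hx, y, hy, rfl⟩
  refine ((X ×ˢ X).finite_toSet.image fun z => lpDist p z.1 z.2).subset ?_
  rintro t ⟨x, hx, y, hy, rfl⟩
  exact ⟨(x, y), by simp [hx, hy], rfl⟩

/-- The infimum over a finite nonempty set is attained, so the default value `0` for an empty set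
does not interfere when two distinct points exist. -/
theorem lpMinDist_pos_and_le {d : ℕ} {p : ℝ} (hp : 0 < p) {X : Finset (Fin d → ℝ)}
    {x y : Fin d → ℝ} (hx : x ∈ X) (hy : y ∈ X) (hxy : x ≠ y) :
    0 < lpMinDist p X ∧ lpMinDist p X ≤ lpDist p x y := by
  have hfin : {t : ℝ | ∃ x ∈ X, ∃ y ∈ X, x ≠ y ∧ t = lpDist p x y}.Finite := by
    refine ((X ×ˢ X).finite_toSet.image fun z => lpDist p z.1 z.2).subset ?_
    rintro t ⟨x, hx, y, hy, -, rfl⟩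
    exact ⟨(x, y), by simp [hx, hy], rfl⟩
  have hmem : lpDist p x y ∈ {t : ℝ | ∃ x ∈ X, ∃ y ∈ X, x ≠ y ∧ t = lpDist p x y} :=
    ⟨x, hx, y, hy, hxy, rfl⟩
  refine ⟨?_, csInf_le hfin.bddBelow hmem⟩
  obtain ⟨x', -, y', -, hne, he⟩ := Set.Nonempty.csInf_mem ⟨_, hmem⟩ hfin
  rw [lpMinDist, he]
  exact lpDist_pos hp hne

theorem le_mul_lpDist_of_div_lpMinDist_le {d : ℕ} {p R Φ : ℝ} (hp : 0 < p) (hΦ : 0 ≤ Φ)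
    {X : Finset (Fin d → ℝ)} (hX : R / lpMinDist p X ≤ Φ)
    {x y : Fin d → ℝ} (hx : x ∈ X) (hy : y ∈ X) (hxy : x ≠ y) : R ≤ Φ * lpDist p x y := by
  obtain ⟨h1, h2⟩ := lpMinDist_pos_and_le hp hx hy hxy
  exact ((div_le_iff₀ h1).1 hX).trans (by gcongr)

/-- Sets with at most one point embed into any Hamming cube. -/
theorem exists_measure_embedsWithDistortion_of_subsingleton (d m n : ℕ) {p : ℝ} (hp : 0 < p)
    (D : ℝ) :
    ∃ (E : Measure ((Fin d → ℝ) → (Fin m → Bool))) (s : ℝ),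
      IsProbabilityMeasure E ∧ 0 < s ∧ ∀ X : Finset (Fin d → ℝ),
        (∀ x ∈ X, ∀ y ∈ X, x = y) →
          1 - 1 / (n : ℝ) ^ 10 ≤ E.real {φ | EmbedsWithDistortion p D s X φ} := by
  refine ⟨Measure.dirac fun _ _ => false, 1, inferInstance, one_pos, fun X hX => ?_⟩
  have h1 : {φ : (Fin d → ℝ) → (Fin m → Bool) | EmbedsWithDistortion p D 1 X φ} = Set.univ := by
    refine Set.eq_univ_of_forall fun φ x hx y hy => ?_
    rw [hX x hx y hy]
    simp [lpDist_self hp]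
  rw [h1, probReal_univ]
  linarith [show (0 : ℝ) ≤ 1 / (n : ℝ) ^ 10 by positivity]

/-- Rounding up costs at most `1`, which is at most `A log n / log 2`. -/
theorem natCeil_mul_log_le {n : ℕ} (hn : 2 ≤ n) {A b : ℝ} (hA : 1 ≤ A) (hb : 0 ≤ b) :
    (⌈b * (A * Real.log n)⌉₊ : ℝ) ≤ (b + 1 / Real.log 2) * (A * Real.log n) := by
  have hl2 : 0 < Real.log 2 := Real.log_pos (by norm_num)
  have hln : Real.log 2 ≤ Real.log n :=
    Real.log_le_log (by norm_num) (by exact_mod_cast hn)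
  have h1 : 1 ≤ 1 / Real.log 2 * (A * Real.log n) := by
    rw [one_div, inv_mul_eq_div, one_le_div hl2]
    nlinarith
  have h2 : 0 ≤ b * (A * Real.log n) := mul_nonneg hb (by nlinarith)
  linarith [(Nat.ceil_lt_add_one h2).le]

/-! ### The two random cuts and the theorem -/

/-- The case `1 < p ≤ 2` at a fixed scale `R`, for a given dimension `m` of the cube. -/
theorem exists_measure_embedsWithDistortion_of_stable {p K : ℝ} (hp : 0 < p) (ν : Measure ℝ)
    [IsProbabilityMeasure ν] (hK : 0 < K) (hint : Integrable (fun x : ℝ => |x|) ν)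
    (hpos : 0 < ∫ x, |x| ∂ν) (hKM : (∫ x, |x| ∂ν) / 2 ≤ ∫ x in {x | |x| ≤ K}, |x| ∂ν)
    {d : ℕ} (hproj : ∀ x y : Fin d → ℝ,
        (Measure.pi fun _ : Fin d => ν).map (fun θ => ∑ i, (x i - y i) * θ i) =
          ν.map fun s => lpDist p x y * s)
    {m n : ℕ} (hn : 2 ≤ n) {Φ R : ℝ} (hΦ : 0 < Φ) (hR : 0 < R)
    (hm : 78 * K / (∫ x, |x| ∂ν) * (Φ * Real.log n) ≤ m) :
    ∃ (E : Measure ((Fin d → ℝ) → (Fin m → Bool))) (s : ℝ),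
      IsProbabilityMeasure E ∧ 0 < s ∧
      ∀ X : Finset (Fin d → ℝ), X.card ≤ n →
        lpMaxDist p X ≤ R → R / lpMinDist p X ≤ Φ →
        1 - 1 / (n : ℝ) ^ 10 ≤ E.real {φ | EmbedsWithDistortion p 32 s X φ} := by
  set M := ∫ x, |x| ∂ν with hM
  have hlog : 0 < Real.log n := Real.log_pos (by exact_mod_cast (by omega : 1 < n))
  have hm0 : (0 : ℝ) < m := lt_of_lt_of_le (by positivity) hm
  set L := M / (2 * K * R) with hL
  have hL0 : 0 < L := by positivity
  set g : (Fin d → ℝ) → (Fin d → ℝ) → ℝ := fun x θ => (∑ i, x i * θ i) / (2 * K * R) with hg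
  have hgm : ∀ x, Measurable (g x) := fun x => by fun_prop
  -- Since `R ≤ Φδ`, the value `a = M/(2KΦ)` is a lower bound for `Lδ`; the constant `78 K / M` is
  -- what makes `m a ≥ 39 log n`.
  obtain ⟨E, hE, hEX⟩ := exists_measure_embedsWithDistortion
    ((Measure.pi fun _ : Fin d => ν).prod unitUniform) hp
    (fun z x => halfCut (g x z.1 + z.2)) (fun x => measurable_halfCut_add (hgm x))
    (m := m) hn (a := M / (2 * K * Φ)) (L := L) (by
      have : 39 * Real.log n =
          78 * K / M * (Φ * Real.log n) * (M / (2 * K * Φ)) := by field_simp; norm_num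
      rw [this]
      gcongr)
  refine ⟨E, m * L / 4, hE, by positivity, fun X hX hmax hmin => hEX X hX fun x hx y hy hxy => ?_⟩
  set δ := lpDist p x y with hδ
  have hδ0 : 0 < δ := lpDist_pos hp hxy
  have hδR : δ ≤ R := (lpDist_le_lpMaxDist hx hy).trans hmax
  have hRδ : R ≤ Φ * δ := le_mul_lpDist_of_div_lpMinDist_le hp hΦ.le hmin hx hy hxy
  have hdiff : ∀ θ, g x θ - g y θ = (∑ i, (x i - y i) * θ i) / (2 * K * R) := by
    intro θ
    simp only [hg, ← sub_div, ← Finset.sum_sub_distrib, sub_mul]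
  have habs : ∀ s : ℝ, |δ * s / (2 * K * R)| = δ / (2 * K * R) * |s| := by
    intro s
    rw [abs_div, abs_mul, abs_of_pos hδ0, abs_of_pos (show 0 < 2 * K * R by positivity)]
    ring
  have htr : ∀ f : ℝ → ℝ, Measurable f →
      ∫ θ, f (∑ i, (x i - y i) * θ i) ∂(Measure.pi fun _ : Fin d => ν) =
        ∫ s, f (δ * s) ∂ν := by
    intro f hf
    rw [← integral_map (φ := fun θ : Fin d → ℝ => ∑ i, (x i - y i) * θ i)
      (Measurable.aemeasurable (by fun_prop)) hf.aestronglyMeasurable, hproj, integral_map (by fun_prop) hf.aestronglyMeasurable]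
  have hgint : Integrable (fun θ => |g x θ - g y θ|) (Measure.pi fun _ : Fin d => ν) := by
    have h1 : Integrable (fun s : ℝ => |s / (2 * K * R)|)
        ((Measure.pi fun _ : Fin d => ν).map (fun θ => ∑ i, (x i - y i) * θ i)) := by
      rw [hproj, integrable_map_measure (by fun_prop) (by fun_prop)]
      simp only [Function.comp_def]
      rw [← hδ]
      simp_rw [habs]
      exact hint.const_mul _
    rw [integrable_map_measure (by fun_prop) (Measurable.aemeasurable (by fun_prop))] at h1
    simp_rw [hdiff]
    exact h1
  have hfull : ∫ θ, |g x θ - g y θ| ∂(Measure.pi fun _ : Fin d => ν) = L * δ := by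
    simp_rw [hdiff]
    rw [htr (fun s => |s / (2 * K * R)|) (by fun_prop)]
    simp_rw [habs]
    rw [integral_const_mul, hL]
    ring
  have htrunc : L * δ / 2 ≤
      ∫ θ in {θ | |g x θ - g y θ| ≤ 1 / 2}, |g x θ - g y θ| ∂(Measure.pi fun _ : Fin d => ν) := by
    have hms : MeasurableSet {s : ℝ | |s / (2 * K * R)| ≤ 1 / 2} :=
      measurableSet_le (by fun_prop) measurable_const
    have hmg : MeasurableSet {θ | |g x θ - g y θ| ≤ 1 / 2} :=
      measurableSet_le (measurable_abs.comp ((hgm x).sub (hgm y))) measurable_const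
    rw [← integral_indicator hmg]
    have h1 : ∀ θ, {θ | |g x θ - g y θ| ≤ 1 / 2}.indicator (fun θ => |g x θ - g y θ|) θ =
        {s : ℝ | |s / (2 * K * R)| ≤ 1 / 2}.indicator (fun s => |s / (2 * K * R)|)
          (∑ i, (x i - y i) * θ i) := by
      intro θ
      simp only [Set.indicator, Set.mem_ofPred_eq, hdiff]
    simp_rw [h1]
    rw [htr _ (Measurable.indicator (by fun_prop) hms)]
    have hmK : MeasurableSet {s : ℝ | |s| ≤ K} := measurableSet_le measurable_abs measurable_const
    calc L * δ / 2 = δ / (2 * K * R) * (M / 2) := by rw [hL]; ring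
      _ ≤ δ / (2 * K * R) * ∫ s in {s | |s| ≤ K}, |s| ∂ν := by gcongr
      _ = ∫ s, {s : ℝ | |s| ≤ K}.indicator (fun s => δ / (2 * K * R) * |s|) s ∂ν := by
        rw [integral_indicator hmK, integral_const_mul]
      _ ≤ _ := by
        have hi : Integrable (fun s => δ / (2 * K * R) * |s|) ν := hint.const_mul _
        refine integral_mono (hi.indicator hmK) ?_ fun s => ?_
        · refine Integrable.mono' hi ?_ (Filter.Eventually.of_forall fun s => ?_)
          · exact ((Measurable.indicator (by fun_prop) hms).comp
              (measurable_const_mul δ)).aestronglyMeasurable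
          · rw [← habs]
            simp only [Set.indicator]
            split_ifs <;> simp
        · by_cases hs : |s| ≤ K
          -- The scale `2KR` is chosen for this: `|s| ≤ K` and `δ ≤ R` bring the difference below
          -- `1/2`.
          · have hs' : |δ * s / (2 * K * R)| ≤ 1 / 2 := by
              rw [habs, div_mul_eq_mul_div, div_le_iff₀ (by positivity)]
              calc δ * |s| ≤ R * K := by gcongr
                _ = 1 / 2 * (2 * K * R) := by ring
            rw [Set.indicator_of_mem (show s ∈ {s : ℝ | |s| ≤ K} from hs),
              Set.indicator_of_mem (show δ * s ∈ {s : ℝ | |s / (2 * K * R)| ≤ 1 / 2} from hs'),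
              habs]
          · rw [Set.indicator_of_notMem (show s ∉ {s : ℝ | |s| ≤ K} from hs)]
            exact Set.indicator_nonneg (fun s _ => abs_nonneg _) _
  refine ⟨?_, ?_, ?_⟩
  · rw [hL, div_mul_eq_mul_div, div_le_div_iff₀ (by positivity) (by positivity)]
    calc M * (2 * K * R) ≤ M * (2 * K * (Φ * δ)) := by gcongr
      _ = M * δ * (2 * K * Φ) := by ring
  · have := le_measureReal_halfCut_ne (Measure.pi fun _ : Fin d => ν) (hgm x) (hgm y) hgint
    exact le_trans (by linarith) this
  · have := measureReal_halfCut_ne_le (Measure.pi fun _ : Fin d => ν) (hgm x) (hgm y) hgint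
    rw [hfull] at this
    exact this

/-- The case `p = 1`, for a given dimension `m` of the cube. -/
theorem exists_measure_embedsWithDistortion_one {d m n : ℕ} (hn : 2 ≤ n) {r R : ℝ} (hr : 0 < r)
    (hd : 0 < d) (hR : 0 < R) (hm : 39 * (d * R / r * Real.log n) ≤ m) :
    ∃ (E : Measure ((Fin d → ℝ) → (Fin m → Bool))) (s : ℝ),
      IsProbabilityMeasure E ∧ 0 < s ∧
      ∀ X : Finset (Fin d → ℝ), X.card ≤ n →
        (∀ x ∈ X, ∀ y ∈ X, ‖x - y‖ ≤ R) →
        (∀ x ∈ X, ∀ y ∈ X, x ≠ y → r ≤ lpDist 1 x y) →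
        1 - 1 / (n : ℝ) ^ 10 ≤ E.real {φ | EmbedsWithDistortion 1 32 s X φ} := by
  have hd0 : (0 : ℝ) < d := by exact_mod_cast hd
  have hlog : 0 < Real.log n := Real.log_pos (by exact_mod_cast (by omega : 1 < n))
  have hm0 : (0 : ℝ) < m := lt_of_lt_of_le (by positivity) hm
  set P : Measure (Fin d) := (d : ENNReal)⁻¹ • Measure.count with hP
  have hPp : IsProbabilityMeasure P := ⟨by
    rw [hP, Measure.smul_apply, Measure.count_univ, smul_eq_mul]
    simp only [ENat.card_eq_coe_fintype_card, Fintype.card_fin]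
    exact ENNReal.inv_mul_cancel (by exact_mod_cast hd.ne') (by simp)⟩
  have hPint : ∀ f : Fin d → ℝ, ∫ i, f i ∂P = (d : ℝ)⁻¹ * ∑ i, f i := by
    intro f
    rw [hP, integral_smul_measure, integral_count]
    simp
  set L := 1 / (d * R) with hL
  obtain ⟨E, hE, hEX⟩ := exists_measure_embedsWithDistortion (d := d)
    (P.prod unitUniform) one_pos
    (fun z x => halfCut (x z.1 / (2 * R) + z.2))
    (fun x => measurable_halfCut_add (g := fun i => x i / (2 * R)) (measurable_of_finite _))
    (m := m) hn (a := r / (d * R)) (L := L) (by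
      have : 39 * Real.log n = 39 * (d * R / r * Real.log n) * (r / (d * R)) := by field_simp
      rw [this]
      gcongr)
  refine ⟨E, m * L / 4, hE, by positivity, fun X hX hmax hmin => hEX X hX fun x hx y hy hxy => ?_⟩
  have hxR : ∀ i, |x i / (2 * R) - y i / (2 * R)| = |x i - y i| / (2 * R) := fun i => by
    rw [← sub_div, abs_div, abs_of_pos (show 0 < 2 * R by positivity)]
  have hint : Integrable (fun i => |x i / (2 * R) - y i / (2 * R)|) P := Integrable.of_finite
  have hfull : ∫ i, |x i / (2 * R) - y i / (2 * R)| ∂P = L * lpDist 1 x y / 2 := by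
    rw [hPint, lpDist_eq one_pos]
    simp_rw [hxR, Real.rpow_one]
    rw [one_div_one, Real.rpow_one, ← Finset.sum_div, hL]
    field_simp
  -- Every coordinate difference is at most `R`, so truncation loses nothing and the separation
  -- probability is exactly `Lδ`.
  have hall : {i | |x i / (2 * R) - y i / (2 * R)| ≤ 1 / 2} = Set.univ := by
    refine Set.eq_univ_of_forall fun i => ?_
    have h1 : |x i - y i| ≤ R := (norm_le_pi_norm (x - y) i).trans (hmax x hx y hy)
    simp only [Set.mem_ofPred_eq]
    rw [hxR, div_le_iff₀ (by positivity)]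
    linarith
  have hlow := le_measureReal_halfCut_ne P (g₁ := fun i => x i / (2 * R))
    (g₂ := fun i => y i / (2 * R)) (measurable_of_finite _) (measurable_of_finite _) hint
  have hup := measureReal_halfCut_ne_le P (g₁ := fun i => x i / (2 * R))
    (g₂ := fun i => y i / (2 * R)) (measurable_of_finite _) (measurable_of_finite _) hint
  rw [hall, setIntegral_univ, hfull] at hlow
  rw [hfull] at hup
  have hpos : 0 < L * lpDist 1 x y := mul_pos (by positivity) (lpDist_pos one_pos hxy)
  refine ⟨?_, by linarith, by linarith⟩
  rw [hL, div_mul_eq_mul_div, one_mul]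
  gcongr
  exact hmin x hx y hy hxy

theorem lpDist_one_le {d : ℕ} (x y : Fin d → ℝ) : lpDist 1 x y ≤ d * ‖x - y‖ := by
  rw [lpDist_eq one_pos]
  simp_rw [Real.rpow_one]
  rw [one_div_one, Real.rpow_one]
  calc ∑ i, |x i - y i| ≤ ∑ _i : Fin d, ‖x - y‖ :=
        Finset.sum_le_sum fun i _ => norm_le_pi_norm (x - y) i
    _ = d * ‖x - y‖ := by simp

theorem mainTheorem8 :
    -- the case `1 < p ≤ 2`; the distribution is given by the scale `R`
    (∃ D : ℝ, ∀ p : ℝ, 1 < p → p ≤ 2 → ∃ C : ℝ,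
      ∀ (n d : ℕ) (Φ : ℝ), 0 ≤ Φ →
        ∃ d' : ℕ, (d' : ℝ) ≤ C * (Φ * Real.log n) ∧
          ∀ R : ℝ, 0 < R →
            ∃ (E : Measure ((Fin d → ℝ) → (Fin d' → Bool))) (s : ℝ),
              IsProbabilityMeasure E ∧ 0 < s ∧
              ∀ X : Finset (Fin d → ℝ), X.card ≤ n →
                lpMaxDist p X ≤ R → R / lpMinDist p X ≤ Φ →
                1 - 1 / (n : ℝ) ^ 10 ≤ E.real {φ | EmbedsWithDistortion p D s X φ}) ∧
    -- the case `p = 1`; here `‖x - y‖` is the sup norm on `Fin d → ℝ`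
    (∃ D C : ℝ,
      ∀ (n d : ℕ) (r R : ℝ), 0 < r → 0 ≤ R →
        ∃ d' : ℕ, (d' : ℝ) ≤ C * (d * R * Real.log n / r) ∧
          ∃ (E : Measure ((Fin d → ℝ) → (Fin d' → Bool))) (s : ℝ),
            IsProbabilityMeasure E ∧ 0 < s ∧
            ∀ X : Finset (Fin d → ℝ), X.card ≤ n →
              (∀ x ∈ X, ∀ y ∈ X, ‖x - y‖ ≤ R) →
              (∀ x ∈ X, ∀ y ∈ X, x ≠ y → r ≤ lpDist 1 x y) →
              1 - 1 / (n : ℝ) ^ 10 ≤ E.real {φ | EmbedsWithDistortion 1 D s X φ}) := by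
  refine ⟨⟨32, fun p hp hp2 => ?_⟩, ⟨32, 39 + 1 / Real.log 2, fun n d r R hr hR => ?_⟩⟩
  · have hp0 : 0 < p := by linarith
    obtain ⟨ν, K, hν, hK, hint, hpos, hKM, hproj⟩ := exists_stable_projection hp hp2
    set b := 78 * K / ∫ x, |x| ∂ν with hb
    have hb0 : 0 ≤ b := by positivity
    refine ⟨b + 1 / Real.log 2, fun n d Φ hΦ => ?_⟩
    -- Otherwise no admissible `X` has two points, since `R ≤ Φδ ≤ ΦR` for a distinct pair, and
    -- dimension `0` suffices.
    by_cases hc : 2 ≤ n ∧ 1 ≤ Φ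
    · exact ⟨⌈b * (Φ * Real.log n)⌉₊, natCeil_mul_log_le hc.1 hc.2 hb0, fun R hR =>
        exists_measure_embedsWithDistortion_of_stable hp0 ν hK hint hpos hKM (hproj d) hc.1
          (by linarith [hc.2]) hR (Nat.le_ceil _)⟩
    · refine ⟨0, ?_, fun R hR => ?_⟩
      · have h1 : 0 ≤ Real.log n := Real.log_natCast_nonneg n
        have h2 : 0 ≤ Real.log 2 := Real.log_nonneg (by norm_num)
        rw [Nat.cast_zero]
        positivity
      · obtain ⟨E, s, hE, hs, hEX⟩ :=
          exists_measure_embedsWithDistortion_of_subsingleton d 0 n hp0 32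
        refine ⟨E, s, hE, hs, fun X hX hmax hmin => hEX X fun x hx y hy => ?_⟩
        by_contra hxy
        refine hc ⟨(Finset.one_lt_card.2 ⟨x, hx, y, hy, hxy⟩).trans_le hX, ?_⟩
        have h1 := le_mul_lpDist_of_div_lpMinDist_le hp0 hΦ hmin hx hy hxy
        have h2 := (lpDist_le_lpMaxDist (p := p) hx hy).trans hmax
        by_contra h3
        nlinarith [lpDist_pos hp0 hxy]
  -- A distinct pair forces `r ≤ ‖x - y‖_1 ≤ dR`, so the other case is again degenerate.
  · by_cases hc : 2 ≤ n ∧ r ≤ d * R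
    · have hdR : 0 < d * R := hr.trans_le hc.2
      have hd : 0 < d := Nat.pos_of_ne_zero fun h => by simp [h] at hdR
      have hR0 : 0 < R := hR.lt_of_ne fun h => by simp [← h] at hdR
      refine ⟨⌈39 * (d * R / r * Real.log n)⌉₊, ?_,
        exists_measure_embedsWithDistortion_one hc.1 hr hd hR0 (Nat.le_ceil _)⟩
      rw [show d * R * Real.log n / r = d * R / r * Real.log n by ring]
      exact natCeil_mul_log_le hc.1 ((one_le_div hr).2 hc.2) (by norm_num)
    · refine ⟨0, ?_, ?_⟩
      · have h1 : 0 ≤ Real.log n := Real.log_natCast_nonneg n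
        have h2 : 0 ≤ Real.log 2 := Real.log_nonneg (by norm_num)
        rw [Nat.cast_zero]
        positivity
      · obtain ⟨E, s, hE, hs, hEX⟩ :=
          exists_measure_embedsWithDistortion_of_subsingleton d 0 n one_pos 32
        refine ⟨E, s, hE, hs, fun X hX hmax hmin => hEX X fun x hx y hy => ?_⟩
        by_contra hxy
        refine hc ⟨(Finset.one_lt_card.2 ⟨x, hx, y, hy, hxy⟩).trans_le hX, ?_⟩
        calc r ≤ lpDist 1 x y := hmin x hx y hy hxy
          _ ≤ d * ‖x - y‖ := lpDist_one_le x y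
          _ ≤ d * R := by gcongr; exact hmax x hx y hy
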